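/- Let $M$ be a matroid on a finite ground set $E$ that is simple (no loops and no parallel elements) and connected (any two distinct elements lie in a common circuit), and let $b \subseteq E$ be a basis of $M$. Write $\mathrm{cl}$ for the closure operator of $M$, $(v_e)_{e\in E}$ for the standard basis of $\mathbb R^E$, $v_F=\sum_{e\in F}v_e$ for $F\subseteq E$, and $\mathbb 1=v_E$. Let $\mathrm{crem}_b:\mathbb R^E\to\mathbb R^E$ be the linear map with $v_e\mapsto v_{\mathrm{cl}(b\setminus\{e\})}$ for $e\in b$ and $v_k\mapsto v_k$ for $k\in E\setminus b$. Let $B(M)\subseteq\mathbb R^E/\mathbb R\mathbb 1$ be the support of the projective Bergman fan of $M$, that is, the image of the set of all $a\in\mathbb R^E$ such that for every circuit $C$ of $M$ the minimum of $a$ over $C$ is attained at least twice. Then the following are equivalent: 1. $\mathrm{crem}_b$ maps $\mathbb R\mathbb 1$ into itself, and the induced linear map $\overline{\mathrm{crem}}_b$ on $\mathbb R^E/\mathbb R\mathbb 1$ satisfies $\overline{\mathrm{crem}}_b(B(M))=B(M)$; 2. $\mathrm{crem}_b$ maps $\mathbb R\mathbb 1$ into itself, and the induced linear map satisfies $\overline{\mathrm{crem}}_b(B(M))\subseteq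 B(M)$; 3. the sets $\mathrm{cl}\{i,j\}\setminus\{i,j\}$, indexed by the unordered pairs of distinct elements $i,j\in b$, are pairwise disjoint (for different pairs) and their union is $E\setminus b$ (some of these sets may be empty). -/

import Mathlib

noncomputable section

namespace CremonaMatroid

variable {E : Type*}

/-- Two distinct elements are parallel if neither is a loop and together they have rank one. -/
def Parallel (M : Matroid E) (i j : E) : Prop :=
  i ≠ j ∧ M.IsNonloop i ∧ M.IsNonloop j ∧ M.eRk {i, j} = 1

/-- A matroid is simple if it has neither loops nor parallel elements. -/
def IsSimple (M : Matroid E) : Prop :=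
  (∀ i, ¬ M.IsLoop i) ∧ ∀ i j, ¬ Parallel M i j

/-- A matroid is connected if any two distinct elements lie in a common circuit. -/
def IsConnected (M : Matroid E) : Prop :=
  ∀ i ∈ M.E, ∀ j ∈ M.E, i ≠ j → ∃ C, M.IsCircuit C ∧ i ∈ C ∧ j ∈ C

/-- The vector `v_F = ∑_{i ∈ F} v_i`, that is, the 0/1 indicator vector of `F`. -/
def vec (F : Set E) : E → ℝ := F.indicator 1

/-- The affine Bergman fan: the vectors `a` such that on each circuit the minimum of the
coordinates is attained at least twice. -/
def affineBergman (M : Matroid E) : Set (E → ℝ) :=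
  {a | ∀ C, M.IsCircuit C →
    ∃ i ∈ C, ∃ j ∈ C, i ≠ j ∧ a i = a j ∧ ∀ k ∈ C, a i ≤ a k}

/-- The line spanned by the all-ones vector `v_E`. -/
def onesLine (E : Type*) : Submodule ℝ (E → ℝ) := Submodule.span ℝ {1}

/-- The support of the projective Bergman fan: the image of the affine Bergman fan in the
quotient by the line spanned by the all-ones vector. -/
def bergman (M : Matroid E) : Set ((E → ℝ) ⧸ onesLine E) :=
  (onesLine E).mkQ '' affineBergman M

open Classical in
/-- The Cremona map: the linear map with `v_e ↦ v_{cl (b \ {e})}` for `e ∈ b` and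
`v_k ↦ v_k` for `k ∉ b`. -/
def crem [Finite E] (M : Matroid E) (b : Set E) : (E → ℝ) →ₗ[ℝ] (E → ℝ) :=
  (Pi.basisFun ℝ E).constr ℝ fun e => if e ∈ b then vec (M.closure (b \ {e})) else vec {e}

/-- The condition for a linear endomorphism of `ℝ^E` to induce one of the quotient by the line
spanned by the all-ones vector: it maps this line into itself. -/
def Descends (f : (E → ℝ) →ₗ[ℝ] (E → ℝ)) : Prop :=
  onesLine E ≤ (onesLine E).comap f

/-- The linear map induced on the quotient by the line spanned by the all-ones vector. -/
def descend (f : (E → ℝ) →ₗ[ℝ] (E → ℝ)) (h : Descends f) :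
    ((E → ℝ) ⧸ onesLine E) →ₗ[ℝ] ((E → ℝ) ⧸ onesLine E) :=
  (onesLine E).mapQ (onesLine E) f h

/-- The sets `cl {i, j} \ {i, j}`, indexed by the unordered pairs of distinct elements of `b`,
partition the complement of `b` in the ground set: sets belonging to different pairs are disjoint,
and the union of all of them is the complement of `b`. (Some of the sets may be empty.) -/
def LinesPartition (M : Matroid E) (b : Set E) : Prop :=
  (∀ i ∈ b, ∀ j ∈ b, ∀ k ∈ b, ∀ l ∈ b, i ≠ j → k ≠ l → s(i, j) ≠ s(k, l) →
    Disjoint (M.closure {i, j} \ {i, j}) (M.closure {k, l} \ {k, l})) ∧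
  (⋃ i ∈ b, ⋃ j ∈ b, ⋃ (_ : i ≠ j), (M.closure {i, j} \ {i, j})) = M.E \ b

end CremonaMatroid

end

/-!
Write `D x ⊆ b` for the support of `x`: the set of `e ∈ b` with `x ∉ cl (b \ {e})`. It is the
smallest subset of `b` spanning `x` (`mem_closure_iff_support_subset`). The definition of the
Cremona map gives `crem a x = ∑_{e ∈ b} a e - ∑_{e ∈ D x} a e + [x ∉ b] a x` (`crem_apply`).
Evaluated at the all-ones vector this is `|b| - 1` on `b` and `|b| - |D k| + 1` at `k ∉ b`, so the
map descends to the quotient iff `|D k| = 2` for all `k ∉ b`, that is, iff every such `k` lies on a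
line spanned by two elements of `b` (`descends_crem_iff`). In a simple matroid two different
lines of this kind share at most an element of `b`, so this is the partition property
(`linesPartition_iff`).

Suppose it holds, and let `S = ∑_{e ∈ b} a e`. Then `crem a` has the value `S - a i` at `i ∈ b`
and `S - a i - a j + a k` at `k` with `D k = {i, j}`. From this formula, the square of the map adds
a constant vector, so on the quotient it is an involution and equality of the Bergman fan with its
image follows from inclusion.

For the inclusion, a vector lies in the affine Bergman fan iff all its superlevel sets are flats
(`mem_affineBergman_iff`). If `a` does, and `D k = {i, j}` with `a i < a j`, then `a k = a i`, and
so `crem a k = S - max (a i) (a j)`. Hence an element of `{crem a > t}` whose support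
reaches a level `r ≥ S - t` of `a` has its whole support on that level, and the inequality says
that `a` exceeds `2 r - (S - t) ≥ r` there. Let `f` be in the closure of `{crem a > t}`, and let `r`
be the maximum of `a` on `D f`. If `r < S - t`, then `crem a f > t` by a direct estimate. Otherwise
the elements of level `r` lie in the flat spanned by `{e ∈ b | a e = r}`, the others in the flat
spanned by the rest of `b`; these flats are skew, and `mem_closure_of_mem_closure_union` separates
the two contributions. Either `D f` lies on level `r`, and `a f > 2 r - (S - t)`, which
excludes `f ∈ b` and otherwise says `crem a f > t`; or `f` is on the line through an `i` on level
`r` and a `j` below it, and separation applied to `i ∈ cl {f, j}` gives the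
contradiction `r = a i > 2 r - (S - t) ≥ r`.
-/

open Set

namespace CremonaMatroid

variable {E : Type*} {M : Matroid E} {b : Set E} {a : E → ℝ} {x y z i j k : E}

/-! ### The Bergman fan through superlevel sets -/

/-- A vector lies in the affine Bergman fan iff its strict superlevel sets are flats. -/
theorem mem_affineBergman_iff [Finite E] :
    a ∈ affineBergman M ↔ ∀ t x, x ∈ M.closure {y | t < a y} → t < a x := by
  constructor
  · intro h t x hx
    by_contra hxt
    obtain ⟨C, hCX, hC, hxC⟩ := Matroid.exists_isCircuit_of_mem_closure hx hxt
    obtain ⟨i, hi, j, hj, hij, haij, hmin⟩ := h C hC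
    have hix : i = x := (hCX hi).resolve_right fun hti ↦ hxt (lt_of_lt_of_le hti (hmin x hxC))
    have hjx : j = x := (hCX hj).resolve_right fun htj ↦
      hxt (lt_of_lt_of_le htj (haij ▸ hmin x hxC))
    exact hij (hix.trans hjx.symm)
  · intro h C hC
    obtain ⟨i, hi, hmin⟩ := C.toFinite.exists_minimalFor a C hC.nonempty
    have hmin' : ∀ k ∈ C, a i ≤ a k := fun k hk ↦
      (le_total (a i) (a k)).elim id fun h' ↦ hmin hk h'
    by_contra! hne
    refine lt_irrefl _ (h (a i) i ?_)
    refine M.closure_subset_closure ?_ (hC.mem_closure_sdiff_singleton_of_mem hi)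
    rintro k ⟨hk, hki⟩
    refine lt_of_le_of_ne (hmin' k hk) fun heq ↦ ?_
    obtain ⟨l, hl, hlt⟩ := hne i hi k hk (fun h ↦ hki h.symm) heq
    exact absurd (hmin' l hl) (not_le.2 hlt)

theorem lt_of_mem_closure [Finite E] (ha : a ∈ affineBergman M) {X : Set E}
    {t : ℝ} (hX : ∀ y ∈ X, t < a y) (hx : x ∈ M.closure X) : t < a x :=
  mem_affineBergman_iff.1 ha t x (M.closure_subset_closure hX hx)

theorem min_le_of_mem_closure_pair [Finite E] (ha : a ∈ affineBergman M)
    (hx : x ∈ M.closure {y, z}) : min (a y) (a z) ≤ a x := by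
  by_contra! hlt
  refine lt_irrefl _ (lt_of_mem_closure ha ?_ hx)
  rintro w (rfl | rfl)
  exacts [hlt.trans_le (min_le_left _ _), hlt.trans_le (min_le_right _ _)]

/-! ### Closures relative to a basis -/

/-- For subsets `I`, `J` of a basis that are disjoint, the flat spanned by `I` is unaffected by
contracting `J`: a set `X` in this flat spans no more of it after `J` is added to `X`. -/
theorem mem_closure_of_mem_closure_union {I J X : Set E} (hIJ : M.Indep (I ∪ J))
    (hdisj : Disjoint I J) (hX : X ⊆ M.closure I) (hy : y ∈ M.closure I)
    (hyX : y ∈ M.closure (X ∪ J)) : y ∈ M.closure X := by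
  by_contra hyn
  have hXE : X ⊆ M.E := hX.trans (M.closure_subset_ground I)
  obtain ⟨K, hK⟩ := M.exists_isBasis X
  have hyK : y ∉ M.closure K := hK.closure_eq_closure ▸ hyn
  have hyE := M.mem_ground_of_mem_closure hy
  have hins : M.Indep (insert y K) :=
    (hK.indep.notMem_closure_iff hyE).1 hyK |>.1
  obtain ⟨L, hL, hKL⟩ := hins.subset_isBasis_of_subset
    (insert_subset hy (hK.subset.trans hX))
  have hLI : M.closure L = M.closure I := hL.closure_eq_closure.trans (M.closure_closure I)
  have hLJ : M.Indep (L ∪ J) := by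
    rw [Matroid.Indep.union_indep_iff_forall_notMem_closure_right hL.indep
      (hIJ.subset subset_union_right)]
    rintro e ⟨heJ, -⟩ hecl
    rw [M.closure_union_congr_left hLI] at hecl
    refine hIJ.notMem_closure_sdiff_of_mem (Or.inr heJ) (M.closure_subset_closure ?_ hecl)
    rintro f (hf | hf)
    · exact ⟨Or.inl hf, fun h ↦ hdisj.notMem_of_mem_left hf (h ▸ heJ)⟩
    · exact ⟨Or.inr hf.1, hf.2⟩
  have hyJ : y ∉ J := fun h ↦ by
    refine hIJ.notMem_closure_sdiff_of_mem (Or.inr h) (M.closure_subset_closure ?_ hy)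
    exact fun f hf ↦ ⟨Or.inl hf, fun h' ↦ hdisj.notMem_of_mem_left hf (h' ▸ h)⟩
  refine hLJ.notMem_closure_sdiff_of_mem (Or.inl (hKL (mem_insert y K)))
    (M.closure_subset_closure (X := K ∪ J) ?_ ?_)
  · rintro f (hf | hf)
    · refine ⟨Or.inl (hKL (mem_insert_of_mem _ hf)), fun h ↦ hyK ?_⟩
      exact h ▸ M.mem_closure_of_mem hf hK.indep.subset_ground
    · exact ⟨Or.inr hf, fun h ↦ hyJ (h ▸ hf)⟩
  · rwa [M.closure_union_congr_left hK.closure_eq_closure]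

/-- The support of `x` with respect to `b`: the elements of `b` that cannot be omitted when
spanning `x`. For `b` a basis, this is `{x}` if `x ∈ b`, and otherwise the fundamental circuit
of `x` without `x`. -/
def support (M : Matroid E) (b : Set E) (x : E) : Set E := {e ∈ b | x ∉ M.closure (b \ {e})}

theorem mem_closure_iff_support_subset (hE : M.E = univ) (hb : M.IsBase b) {J : Set E}
    (hJ : J ⊆ b) : x ∈ M.closure J ↔ support M b x ⊆ J := by
  constructor
  · intro hx e he
    by_contra heJ
    exact he.2
      (M.closure_subset_closure (subset_sdiff_singleton hJ heJ) hx)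
  · intro h
    have hbx : b ∈ {J | J ⊆ b ∧ x ∈ M.closure J} :=
      ⟨subset_rfl, by rw [hb.closure_eq, hE]; trivial⟩
    have hx : x ∈ M.closure (⋂₀ {J | J ⊆ b ∧ x ∈ M.closure J}) := by
      rw [hb.indep.closure_sInter_eq_biInter_closure_of_forall_subset ⟨b, hbx⟩ fun J hJ ↦ hJ.1]
      simp
    refine M.closure_subset_closure ?_ hx
    refine fun e he ↦ h ⟨he b hbx, fun hxe ↦ ?_⟩
    exact (he _ ⟨sdiff_subset, hxe⟩).2 rfl

theorem support_of_mem (hb : M.IsBase b) (hx : x ∈ b) : support M b x = {x} := by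
  ext e
  constructor
  · rintro ⟨he, hxe⟩
    by_contra hne
    exact hxe (M.mem_closure_of_mem ⟨hx, fun h ↦ hne h.symm⟩
      (sdiff_subset.trans hb.subset_ground))
  · rintro rfl
    exact ⟨hx, hb.indep.notMem_closure_sdiff_of_mem hx⟩

theorem IsSimple.eq_of_mem_closure_singleton (hM : IsSimple M) (hx : x ∈ M.closure {y}) :
    x = y := by
  by_contra hne
  have hxE := M.mem_ground_of_mem_closure hx
  have hxn : M.IsNonloop x := (M.not_isLoop_iff hxE).1 (hM.1 x)
  have hyn : M.IsNonloop y := hxn.isNonloop_of_mem_closure hx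
  refine hM.2 x y ⟨hne, hxn, hyn, ?_⟩
  rw [← M.eRk_closure_eq, M.closure_insert_eq_of_mem_closure hx, M.eRk_closure_eq, hyn.eRk_eq]

/-! ### Lines spanned by pairs of basis elements -/

/-- Every element outside `b` lies on a line spanned by two elements of `b`, stated through
supports. -/
def CoveredByLines (M : Matroid E) (b : Set E) : Prop :=
  ∀ k ∉ b, ∃ i ∈ b, ∃ j ∈ b, i ≠ j ∧ support M b k = {i, j}

theorem support_eq_pair_iff (hE : M.E = univ) (hM : IsSimple M) (hb : M.IsBase b) (hi : i ∈ b)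
    (hj : j ∈ b) (hij : i ≠ j) : support M b k = {i, j} ↔ k ∈ M.closure {i, j} \ {i, j} := by
  have hsub : {i, j} ⊆ b := insert_subset hi (singleton_subset_iff.2 hj)
  constructor
  · intro h
    refine ⟨(mem_closure_iff_support_subset hE hb hsub).2 h.subset, ?_⟩
    rintro (rfl | rfl)
    · rw [support_of_mem hb hi] at h
      exact hij (h.symm.subset (Or.inr rfl)).symm
    · rw [support_of_mem hb hj] at h
      exact hij (h.symm.subset (Or.inl rfl))
  · rintro ⟨hk, hkn⟩
    have hsup := (mem_closure_iff_support_subset hE hb hsub).1 hk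
    have hmem : ∀ l ∈ b, support M b k ⊆ {l} → k = l := fun l hl h ↦
      hM.eq_of_mem_closure_singleton
        ((mem_closure_iff_support_subset hE hb (singleton_subset_iff.2 hl)).2 h)
    refine subset_antisymm hsup ?_
    rintro l (rfl | rfl)
    · by_contra hl
      exact hkn (Or.inr (hmem j hj fun e he ↦ (hsup he).resolve_left fun h ↦ hl (h ▸ he)))
    · by_contra hl
      exact hkn (Or.inl (hmem i hi fun e he ↦ (hsup he).resolve_right fun h ↦ hl (h ▸ he)))

theorem left_mem_closure_pair (hE : M.E = univ) (hM : IsSimple M) (hb : M.IsBase b)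
    (hi : i ∈ b) (hj : j ∈ b) (hij : i ≠ j) (hs : support M b k = {i, j}) :
    i ∈ M.closure {k, j} := by
  have hk := (support_eq_pair_iff hE hM hb hi hj hij).1 hs
  refine (M.closure_exchange ⟨hk.1, fun h ↦ hk.2 (Or.inr ?_)⟩).1
  exact hM.eq_of_mem_closure_singleton h

theorem linesPartition_iff (hE : M.E = univ) (hM : IsSimple M) (hb : M.IsBase b) :
    LinesPartition M b ↔ CoveredByLines M b := by
  constructor
  · rintro ⟨-, h⟩ k hk
    have hk' : k ∈ M.E \ b := ⟨hE ▸ mem_univ k, hk⟩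
    rw [← h] at hk'
    simp only [mem_iUnion] at hk'
    obtain ⟨i, hi, j, hj, hij, hkij⟩ := hk'
    exact ⟨i, hi, j, hj, hij, (support_eq_pair_iff hE hM hb hi hj hij).2 hkij⟩
  · intro h
    refine ⟨fun i hi j hj k hk l hl hij hkl hne ↦ ?_, ?_⟩
    · rw [Set.disjoint_left]
      intro x hx hx'
      have h1 := (support_eq_pair_iff hE hM hb hi hj hij).2 hx
      have h2 := (support_eq_pair_iff hE hM hb hk hl hkl).2 hx'
      rw [h1, pair_eq_pair_iff] at h2
      exact hne (Sym2.eq_iff.2 h2)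
    · ext k
      simp only [mem_iUnion]
      constructor
      · rintro ⟨i, hi, j, hj, hij, hk⟩
        refine ⟨hE ▸ mem_univ k, fun hkb ↦ ?_⟩
        have h1 := (support_eq_pair_iff hE hM hb hi hj hij).2 hk
        rw [support_of_mem hb hkb] at h1
        exact hk.2 (h1.subset rfl)
      · rintro ⟨-, hk⟩
        obtain ⟨i, hi, j, hj, hij, hkij⟩ := h k hk
        exact ⟨i, hi, j, hj, hij, (support_eq_pair_iff hE hM hb hi hj hij).1 hkij⟩

/-! ### Coordinates of the Cremona map -/

theorem crem_apply [Finite E] (M : Matroid E) (b : Set E) (a : E → ℝ) (x : E) :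
    crem M b a x =
      ∑ᶠ e ∈ b, a e - ∑ᶠ e ∈ support M b x, a e + bᶜ.indicator a x := by
  classical
  have := Fintype.ofFinite E
  have hsum : bᶜ.indicator a x = ∑ e, if e ∈ b then 0 else if x = e then a e else 0 := by
    rw [Finset.sum_eq_single x]
    · by_cases hx : x ∈ b <;> simp [hx]
    · intro e _ he
      simp [he.symm]
    · simp
  rw [crem, Module.Basis.constr_apply_fintype, finsum_mem_def, finsum_mem_def,
    finsum_eq_sum_of_fintype, finsum_eq_sum_of_fintype, hsum, ← Finset.sum_sub_distrib,
    ← Finset.sum_add_distrib, Finset.sum_apply]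
  refine Finset.sum_congr rfl fun e _ ↦ ?_
  by_cases he : e ∈ b <;> by_cases hx : x ∈ M.closure (b \ {e}) <;>
    by_cases hxe : x = e <;> simp [he, hx, hxe, vec, support, indicator] <;> grind

theorem crem_apply_of_mem [Finite E] (hb : M.IsBase b) (hi : i ∈ b) (a : E → ℝ) :
    crem M b a i = ∑ᶠ e ∈ b, a e - a i := by
  rw [crem_apply, support_of_mem hb hi, finsum_mem_singleton]
  simp [hi]

theorem crem_apply_of_support_eq [Finite E] (hk : k ∉ b) (hij : i ≠ j)
    (h : support M b k = {i, j}) (a : E → ℝ) :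
    crem M b a k = ∑ᶠ e ∈ b, a e - (a i + a j) + a k := by
  rw [crem_apply, h, finsum_mem_pair hij]
  simp [hk]

theorem descends_iff (f : (E → ℝ) →ₗ[ℝ] (E → ℝ)) : Descends f ↔ ∃ c : ℝ, ∀ x, f 1 x = c := by
  rw [Descends, onesLine, Submodule.span_singleton_le_iff_mem, Submodule.mem_comap,
    Submodule.mem_span_singleton]
  simp only [funext_iff, Pi.smul_apply, Pi.one_apply, smul_eq_mul, mul_one, eq_comm]

/-- The image of the all-ones vector under the Cremona map is constant exactly if all
supports of elements outside `b` have size two. -/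
theorem descends_crem_iff [Finite E] (hE : M.E = univ) (hM : IsSimple M) (hb : M.IsBase b) :
    Descends (crem M b) ↔ CoveredByLines M b := by
  rw [descends_iff]
  constructor
  · rintro ⟨c, hc⟩ k hk
    -- otherwise every element is a loop
    have hne : b.Nonempty := by
      by_contra h
      rw [not_nonempty_iff_eq_empty] at h
      subst h
      refine hM.1 k ?_
      rw [Matroid.isLoop_iff, Matroid.loops, hb.closure_eq, hE]
      trivial
    obtain ⟨i, hi⟩ := hne
    have h1 := (hc i).trans (hc k).symm
    rw [crem_apply_of_mem hb hi, crem_apply] at h1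
    have hcard : ∑ᶠ e ∈ support M b k, (1 : E → ℝ) e = (support M b k).ncard := by
      rw [finsum_mem_eq_finite_toFinset_sum _ (toFinite _), ncard_eq_toFinset_card _ (toFinite _)]
      simp
    have hk' : bᶜ.indicator (1 : E → ℝ) k = 1 := by simp [hk]
    rw [hcard, hk', Pi.one_apply] at h1
    have h2 : (support M b k).ncard = 2 := by
      have : ((support M b k).ncard : ℝ) = 2 := by linarith
      exact_mod_cast this
    obtain ⟨i, j, hij, h⟩ := ncard_eq_two.1 h2
    have hsub : support M b k ⊆ b := fun e he ↦ he.1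
    rw [h] at hsub
    exact ⟨i, hsub (Or.inl rfl), j, hsub (Or.inr rfl), hij, h⟩
  · intro h
    refine ⟨∑ᶠ e ∈ b, (1 : E → ℝ) e - 1, fun x ↦ ?_⟩
    by_cases hx : x ∈ b
    · rw [crem_apply_of_mem hb hx, Pi.one_apply]
    · obtain ⟨i, -, j, -, hij, hs⟩ := h x hx
      rw [crem_apply_of_support_eq hx hij hs]
      simp only [Pi.one_apply]
      ring

/-- Modulo the all-ones vector, the Cremona map is an involution. -/
theorem exists_crem_crem_eq [Finite E] (hb : M.IsBase b) (h : CoveredByLines M b)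
    (a : E → ℝ) : ∃ c : ℝ, ∀ x, crem M b (crem M b a) x = a x + c := by
  refine ⟨∑ᶠ e ∈ b, crem M b a e - ∑ᶠ e ∈ b, a e, fun x ↦ ?_⟩
  by_cases hx : x ∈ b
  · rw [crem_apply_of_mem hb hx, crem_apply_of_mem hb hx]
    ring
  · obtain ⟨i, hi, j, hj, hij, hs⟩ := h x hx
    rw [crem_apply_of_support_eq hx hij hs, crem_apply_of_support_eq hx hij hs,
      crem_apply_of_mem hb hi, crem_apply_of_mem hb hj]
    ring

/-! ### Invariance of the Bergman fan -/

theorem apply_eq_left_of_support_eq_pair [Finite E] (hE : M.E = univ) (hM : IsSimple M)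
    (hb : M.IsBase b) (hi : i ∈ b) (hj : j ∈ b) (hs : support M b k = {i, j})
    (ha : a ∈ affineBergman M) (hlt : a i < a j) : a k = a i := by
  have hij : i ≠ j := fun h ↦ hlt.ne (h ▸ rfl)
  have h1 := min_le_of_mem_closure_pair ha ((support_eq_pair_iff hE hM hb hi hj hij).1 hs).1
  have h2 := min_le_of_mem_closure_pair ha (left_mem_closure_pair hE hM hb hi hj hij hs)
  have h3 := min_le_of_mem_closure_pair ha
    (left_mem_closure_pair hE hM hb hj hi hij.symm (hs.trans (pair_comm i j)))
  grind

/-- The Cremona map preserves the affine Bergman fan: the superlevel sets of the image are flats,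
since they split along the level sets of `a` on `b`, which span mutually skew flats. -/
theorem crem_mem_affineBergman [Finite E] (hE : M.E = univ) (hM : IsSimple M)
    (hb : M.IsBase b) (h : CoveredByLines M b) (ha : a ∈ affineBergman M) :
    crem M b a ∈ affineBergman M := by
  rw [mem_affineBergman_iff]
  intro t f hf
  obtain ⟨S, hS⟩ : ∃ S, S = ∑ᶠ e ∈ b, a e := ⟨_, rfl⟩
  have hcb : ∀ i ∈ b, crem M b a i = S - a i := fun i hi ↦ hS ▸ crem_apply_of_mem hb hi a
  -- `i` may be taken to be any prescribed element of the support
  have hcov : ∀ k ∉ b, ∀ i ∈ support M b k, ∃ j ∈ b, i ≠ j ∧ support M b k = {i, j} ∧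
      crem M b a k = S - (a i + a j) + a k := by
    intro k hk i hi
    obtain ⟨i', hi', j', hj', hij, hs⟩ := h k hk
    have hs' := hs.trans (pair_comm i' j')
    rcases hs ▸ hi with rfl | rfl
    · exact ⟨j', hj', hij, hs, hS ▸ crem_apply_of_support_eq hk hij hs a⟩
    · exact ⟨i', hi', hij.symm, hs', hS ▸ crem_apply_of_support_eq hk hij.symm hs' a⟩
  have hne : ∀ x, (support M b x).Nonempty := by
    intro x
    by_cases hx : x ∈ b
    · exact ⟨x, (support_of_mem hb hx).symm.subset rfl⟩
    · obtain ⟨i, -, j, -, -, hs⟩ := h x hx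
      exact ⟨i, hs.symm.subset (Or.inl rfl)⟩
  -- an element in the superlevel set whose support contains `i` with `S - t ≤ a i` has
  -- its support within one level set of `a`
  have hhigh : ∀ x, t < crem M b a x → ∀ i ∈ support M b x, S - t ≤ a i →
      2 * a i - (S - t) < a x ∧ ∀ j ∈ support M b x, a j = a i := by
    intro x hx i hi hti
    by_cases hxb : x ∈ b
    · rw [support_of_mem hb hxb] at hi
      obtain rfl : i = x := hi
      linarith [hcb i hxb]
    · obtain ⟨j, hj, hij, hs, hc⟩ := hcov x hxb i hi
      have haij : a j = a i := by
        rcases lt_trichotomy (a i) (a j) with hlt | heq | hlt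
        · linarith [apply_eq_left_of_support_eq_pair hE hM hb hi.1 hj hs ha hlt]
        · exact heq.symm
        · linarith [apply_eq_left_of_support_eq_pair hE hM hb hj hi.1
            (hs.trans (pair_comm i j)) ha hlt]
      refine ⟨by linarith, ?_⟩
      rw [hs]
      rintro l (rfl | rfl)
      exacts [rfl, haij]
  obtain ⟨i, hi, hmax⟩ := (support M b f).toFinite.exists_maximalFor a _ (hne f)
  replace hmax : ∀ j ∈ support M b f, a j ≤ a i := fun j hj ↦
    (le_total (a j) (a i)).elim id fun h' ↦ hmax hj h'
  -- all of the support of `f` is below the critical level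
  by_cases hti : a i < S - t
  · by_cases hfb : f ∈ b
    · rw [support_of_mem hb hfb] at hi
      obtain rfl : i = f := hi
      linarith [hcb i hfb]
    · obtain ⟨j, hj, hij, hs, hc⟩ := hcov f hfb i hi
      have h1 := min_le_of_mem_closure_pair ha
        ((support_eq_pair_iff hE hM hb hi.1 hj hij).1 hs).1
      rw [min_eq_right (hmax j (hs.symm.subset (Or.inr rfl)))] at h1
      linarith
  rw [not_lt] at hti
  -- split `b` into the top level of the support of `f` and the rest
  have hI : {e ∈ b | a e = a i} ⊆ b := fun e he ↦ he.1
  have hJ : {e ∈ b | a e ≠ a i} ⊆ b := fun e he ↦ he.1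
  have hdisj : Disjoint {e ∈ b | a e = a i} {e ∈ b | a e ≠ a i} :=
    Set.disjoint_left.2 fun e he he' ↦ he'.2 he.2
  have hIJ : M.Indep ({e ∈ b | a e = a i} ∪ {e ∈ b | a e ≠ a i}) :=
    hb.indep.subset (union_subset hI hJ)
  obtain ⟨X, hX⟩ : ∃ X, X = {x | t < crem M b a x ∧ support M b x ⊆ {e ∈ b | a e = a i}} :=
    ⟨_, rfl⟩
  have hXI : X ⊆ M.closure {e ∈ b | a e = a i} := by
    rintro x hx
    rw [hX] at hx
    exact (mem_closure_iff_support_subset hE hb hI).2 hx.2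
  have hXa : ∀ x ∈ X, 2 * a i - (S - t) < a x := by
    intro x hx
    rw [hX] at hx
    obtain ⟨e, he⟩ := hne x
    have hea := (hx.2 he).2
    exact hea ▸ (hhigh x hx.1 e he (hea.symm ▸ hti)).1
  have hGX : M.closure {y | t < crem M b a y} ⊆ M.closure (X ∪ {e ∈ b | a e ≠ a i}) := by
    refine M.closure_subset_closure_of_subset_closure fun x hx ↦ ?_
    by_cases hxi : ∃ e ∈ support M b x, a e = a i
    · obtain ⟨e, he, hea⟩ := hxi
      refine M.mem_closure_of_mem' (Or.inl ?_) (hE ▸ mem_univ x)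
      rw [hX]
      exact ⟨hx, fun l hl ↦ ⟨hl.1, ((hhigh x hx e he (hea.symm ▸ hti)).2 l hl).trans hea⟩⟩
    · refine M.closure_subset_closure subset_union_right
        ((mem_closure_iff_support_subset hE hb hJ).2 fun e he ↦ ⟨he.1, fun hea ↦ hxi ⟨e, he, hea⟩⟩)
  have hlt : ∀ y ∈ M.closure {e ∈ b | a e = a i}, y ∈ M.closure (X ∪ {e ∈ b | a e ≠ a i}) →
      2 * a i - (S - t) < a y := fun y hy hyX ↦
    lt_of_mem_closure ha hXa (mem_closure_of_mem_closure_union hIJ hdisj hXI hy hyX)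
  have hiI : i ∈ M.closure {e ∈ b | a e = a i} :=
    M.mem_closure_of_mem' ⟨hi.1, rfl⟩ (hE ▸ mem_univ i)
  by_cases hfb : f ∈ b
  · rw [support_of_mem hb hfb] at hi
    obtain rfl : i = f := hi
    linarith [hlt i hiI (hGX hf)]
  · obtain ⟨j, hj, hij, hs, hc⟩ := hcov f hfb i hi
    by_cases haj : a j = a i
    · have hfI : f ∈ M.closure {e ∈ b | a e = a i} := by
        rw [mem_closure_iff_support_subset hE hb hI, hs]
        exact insert_subset ⟨hi.1, rfl⟩ (singleton_subset_iff.2 ⟨hj, haj⟩)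
      linarith [hlt f hfI (hGX hf)]
    · have hiX : i ∈ M.closure (X ∪ {e ∈ b | a e ≠ a i}) := by
        refine M.closure_subset_closure_of_subset_closure ?_
          (left_mem_closure_pair hE hM hb hi.1 hj hij hs)
        refine insert_subset (hGX hf) (singleton_subset_iff.2 ?_)
        exact M.mem_closure_of_mem' (Or.inr ⟨hj, haj⟩) (hE ▸ mem_univ j)
      linarith [hlt i hiI hiX]

end CremonaMatroid

theorem theorem7p3 {E : Type*} [Finite E] (M : Matroid E) (hE : M.E = Set.univ)
    (hsimple : CremonaMatroid.IsSimple M) (hconn : CremonaMatroid.IsConnected M)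
    (b : Set E) (hb : M.IsBase b) :
    ((∃ h : CremonaMatroid.Descends (CremonaMatroid.crem M b),
        CremonaMatroid.descend (CremonaMatroid.crem M b) h '' CremonaMatroid.bergman M
          = CremonaMatroid.bergman M) ↔
      CremonaMatroid.LinesPartition M b) ∧
    ((∃ h : CremonaMatroid.Descends (CremonaMatroid.crem M b),
        Set.MapsTo (CremonaMatroid.descend (CremonaMatroid.crem M b) h)
          (CremonaMatroid.bergman M) (CremonaMatroid.bergman M)) ↔
      CremonaMatroid.LinesPartition M b) := by
  rw [CremonaMatroid.linesPartition_iff hE hsimple hb,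
    ← CremonaMatroid.descends_crem_iff hE hsimple hb]
  have hmaps : ∀ h : CremonaMatroid.Descends (CremonaMatroid.crem M b),
      Set.MapsTo (CremonaMatroid.descend (CremonaMatroid.crem M b) h)
        (CremonaMatroid.bergman M) (CremonaMatroid.bergman M) := by
    rintro h _ ⟨a, ha, rfl⟩
    exact ⟨_, CremonaMatroid.crem_mem_affineBergman hE hsimple hb
      ((CremonaMatroid.descends_crem_iff hE hsimple hb).1 h) ha, rfl⟩
  refine ⟨⟨fun ⟨h, _⟩ ↦ h, fun h ↦ ⟨h, subset_antisymm (hmaps h).image_subset ?_⟩⟩,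
    ⟨fun ⟨h, _⟩ ↦ h, fun h ↦ ⟨h, hmaps h⟩⟩⟩
  rintro _ ⟨a, ha, rfl⟩
  have hcov := (CremonaMatroid.descends_crem_iff hE hsimple hb).1 h
  obtain ⟨c, hc⟩ := CremonaMatroid.exists_crem_crem_eq hb hcov a
  refine ⟨_, ⟨_, CremonaMatroid.crem_mem_affineBergman hE hsimple hb hcov ha, rfl⟩, ?_⟩
  refine (Submodule.Quotient.eq _).2 (Submodule.mem_span_singleton.2 ⟨c, ?_⟩)
  funext x
  simp [hc x]
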